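/- Consider a two-armed bandit in which the $i$-th play of arm $k\in\{1,2\}$, $i\ge 1$, yields the reward $X_k(i)$, where $$X_k(i)=\alpha_k+\beta_kX_k(i-1)+W_k(i),\qquad i\ge 1,$$ with $\alpha_k\in\mathbb R$, $\beta_k\in(0,1)$, independent noise variables $W_k(i)\sim N(0,\sigma_k^2)$, $\sigma_k^2>0$, and initial values $X_k(0)$ with any law, independent of the noise; the reward process of an arm moves forward only when that arm is played. Let $\sigma^2>0$ and let $\pi$ be KL-UCB for iid Gaussian rewards with assumed variance $\sigma^2$: first each arm is played once; then, after $t\ge 2$ rounds, the next arm played is one that maximizes the index $$U_k(t)=\sup\Bigl\{\mu\in\mathbb R:\ D\bigl(N(\hat\mu_k(t),\sigma^2),N(\mu,\sigma^2)\bigr)\le \frac{\log t}{N_k(t)}\Bigr\},$$ where $D$ is the Kullback--Leibler divergence, $N_k(t)$ is the number of plays of arm $k$ up to time $t$ and $\hat\mu_k(t)$ is the sample mean of its rewards. The order of the first plays and the breaking of ties are arbitrary functions of the past observations and of a random seed; the pair consisting of the seed and the initial values is independent of the noise. The long-run means are $\lim_{n\to\infty}\frac1n\sum_{i=1}^nX_k(i)=\alpha_k/(1-\beta_k)$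 almost surely. Suppose that arm $2$ is sub-optimal, i.e. $\alpha_2/(1-\beta_2)<\alpha_1/(1-\beta_1)$. Then for every $\gamma\in(0,1)$, $$\liminf_{T\to\infty}\frac{\log \mathbb P(N_2(T)\ge x)}{\log x}\ \ge\ -\frac{\sigma^2}{\sigma_1^2}(1-\beta_1)^2$$ uniformly for $x\in[\log^{1+\gamma}(T),(1-\gamma)T]$; that is, for every $\varepsilon>0$ and all sufficiently large $T$, every such $x$ satisfies $\mathbb P(N_2(T)\ge x)>0$ and $\log \mathbb P(N_2(T)\ge x)/\log x\ge-\frac{\sigma^2}{\sigma_1^2}(1-\beta_1)^2-\varepsilon$. If moreover the assumed variance is that of the equilibrium distribution of the rewards of each arm, i.e. $\sigma^2=\sigma_k^2/(1-\beta_k^2)$ for $k=1,2$, then $\frac{\sigma^2}{\sigma_1^2}(1-\beta_1)^2=\frac{1-\beta_1}{1+\beta_1}$, and for every $\delta\in\bigl(0,\frac{1+\beta_1}{1-\beta_1}-1\bigr)$, $$\liminf_{T\to\infty}\frac{\mathbb E[N_2(T)]}{T^{\,1-(1+\delta)(1-\beta_1)/(1+\beta_1)}}\ge 1 .$$ -/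

import Mathlib

open MeasureTheory ProbabilityTheory Filter Set
open scoped ENNReal NNReal Topology

/-- The Kullback-Leibler divergence between two Gaussian laws of common variance `v > 0`. -/
theorem klDiv_gaussianReal_gaussianReal (a b : ℝ) {v : ℝ≥0} (hv : v ≠ 0) :
    InformationTheory.klDiv (gaussianReal a v) (gaussianReal b v)
      = ENNReal.ofReal ((a - b) ^ 2 / (2 * v)) := by
  have hv' : (v : ℝ) ≠ 0 := by exact_mod_cast hv
  set g : ℝ → ℝ := fun x => (a - b) * (2 * x - a - b) / (2 * v) with hg
  have hgm : Measurable fun x => ENNReal.ofReal (Real.exp (g x)) := by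
    rw [hg]; fun_prop
  have hdens : gaussianReal a v
      = (gaussianReal b v).withDensity (fun x => ENNReal.ofReal (Real.exp (g x))) := by
    rw [gaussianReal_of_var_ne_zero _ hv, gaussianReal_of_var_ne_zero _ hv,
      ← withDensity_mul _ (measurable_gaussianPDF b v) hgm]
    congr 1
    funext x
    rw [Pi.mul_apply, gaussianPDF, gaussianPDF, ← ENNReal.ofReal_mul (gaussianPDFReal_nonneg _ _ _),
      gaussianPDFReal, gaussianPDFReal, mul_assoc (√(2 * Real.pi * v))⁻¹, ← Real.exp_add]
    congr 3
    rw [hg]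
    field_simp
    ring
  have hac : gaussianReal a v ≪ gaussianReal b v := by
    rw [hdens]; exact withDensity_absolutelyContinuous _ _
  have hllr : llr (gaussianReal a v) (gaussianReal b v) =ᵐ[gaussianReal a v] g := by
    have h : (gaussianReal a v).rnDeriv (gaussianReal b v)
        =ᵐ[gaussianReal b v] fun x => ENNReal.ofReal (Real.exp (g x)) := by
      conv_lhs => rw [hdens]
      exact Measure.rnDeriv_withDensity _ hgm
    filter_upwards [hac.ae_le h] with x hx
    rw [llr, hx, ENNReal.toReal_ofReal (Real.exp_pos _).le, Real.log_exp]
  have hid : Integrable (fun x : ℝ => x) (gaussianReal a v) :=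
    (memLp_id_gaussianReal 1).integrable le_rfl
  have hgaff : g = fun x => ((a - b) / v) * x + (-(a - b) * (a + b) / (2 * v)) := by
    funext x; rw [hg]; field_simp; ring
  have hgint : Integrable g (gaussianReal a v) := by
    rw [hgaff]; exact (hid.const_mul _).add (integrable_const _)
  have hgval : ∫ x, g x ∂(gaussianReal a v) = (a - b) ^ 2 / (2 * v) := by
    rw [hgaff, integral_add (hid.const_mul _) (integrable_const _), integral_const_mul,
      integral_id_gaussianReal]
    simp
    field_simp
    ring
  have hint : Integrable (llr (gaussianReal a v) (gaussianReal b v)) (gaussianReal a v) :=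
    hgint.congr hllr.symm
  rw [InformationTheory.klDiv_of_ac_of_integrable hac hint, integral_congr_ae hllr, hgval]
  simp

namespace Bandit

/-- What a `K`-armed bandit algorithm has seen after `t` rounds: for each round, the arm that was
played and the reward that was received. -/
abbrev History (K t : ℕ) : Type := Fin t → Fin K × ℝ

/-- The number of plays of arm `k` in a history. -/
def plays {K t : ℕ} (h : History K t) (k : Fin K) : ℕ :=
  (Finset.univ.filter fun s : Fin t => (h s).1 = k).card

/-- The sample mean of the rewards of arm `k` in a history. -/
noncomputable def sampleMean {K t : ℕ} (h : History K t) (k : Fin K) : ℝ :=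
  (∑ s ∈ Finset.univ.filter (fun s : Fin t => (h s).1 = k), (h s).2) / (plays h k : ℝ)

/-- A (possibly randomized) bandit algorithm: from a random seed `u : 𝓤` and the history of the
first `t` rounds it chooses the arm to be played in round `t + 1`. -/
abbrev Policy (𝓤 : Type*) (K : ℕ) : Type _ := (t : ℕ) → 𝓤 → History K t → Fin K

/-- The KL-UCB index of arm `k` after `t` rounds, for iid Gaussian rewards of assumed
variance `v`:
the largest `m` such that `D(N(sample mean of arm k, v), N(m, v)) ≤ log t / (plays of arm k)`. -/
noncomputable def gaussianIndex (v : ℝ≥0) {K t : ℕ} (h : History K t) (k : Fin K) : ℝ :=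
  sSup {m : ℝ | InformationTheory.klDiv (gaussianReal (sampleMean h k) v) (gaussianReal m v)
    ≤ ENNReal.ofReal (Real.log t / plays h k)}

/-- `π` is KL-UCB for iid Gaussian rewards with assumed variance `v`: first every arm is
played once, afterwards an arm with the largest index is played.  The order of the first plays
and the breaking of ties are left to the algorithm. -/
structure IsGaussianKLUCB {𝓤 : Type*} {K : ℕ} (v : ℝ≥0) (π : Policy 𝓤 K) : Prop where
  explore : ∀ (t : ℕ) (u : 𝓤) (h : History K t),
    (∃ k, plays h k = 0) → plays h (π t u h) = 0
  exploit : ∀ (t : ℕ) (u : 𝓤) (h : History K t),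
    (∀ k, plays h k ≠ 0) → ∀ k, gaussianIndex v h k ≤ gaussianIndex v h (π t u h)

/-- The history of the first `T` rounds when `π` runs with seed `u` on the reward sequences `X`,
where `X k i` (for `i ≥ 1`) is the reward of the `i`-th play of arm `k`; so the reward process of
an arm moves forward only when that arm is played. -/
def history {𝓤 : Type*} {K : ℕ} (π : Policy 𝓤 K) (u : 𝓤) (X : Fin K → ℕ → ℝ) :
    (T : ℕ) → History K T
  | 0 => Fin.elim0
  | T + 1 =>
    let h := history π u X T
    let k := π T u h
    Fin.snoc (α := fun _ => Fin K × ℝ) h (k, X k (plays h k + 1))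

/-- `N_k(T)`: the number of plays of arm `k` in the first `T` rounds. -/
def numPlays {𝓤 : Type*} {K : ℕ} (π : Policy 𝓤 K) (u : 𝓤) (X : Fin K → ℕ → ℝ)
    (k : Fin K) (T : ℕ) : ℕ :=
  plays (history π u X T) k

/-- The AR(1) sequence with initial value `x₀`: `X 0 = x₀` and
`X (i + 1) = α + β * X i + w i`; here `w i` is the noise of step `i + 1`. -/
def ar1 (α β x₀ : ℝ) (w : ℕ → ℝ) : ℕ → ℝ
  | 0 => x₀
  | i + 1 => α + β * ar1 α β x₀ w i + w i

/-- A probability space that carries a seed `U` for the algorithm and a two-armed Gaussian AR(1)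
environment: initial values `X₀ k` and noise `W k i` such that `W k i` is Gaussian with mean `0`
and variance `s k`, all `W k i` are independent, and they are independent of the initial values
and the seed.  The initial values may have any law. -/
structure IsGaussianAR1Env {Ω 𝓤 : Type*} [MeasurableSpace Ω] [MeasurableSpace 𝓤]
    (P : Measure Ω) (s : Fin 2 → ℝ≥0) (X₀ : Fin 2 → Ω → ℝ) (W : Fin 2 → ℕ → Ω → ℝ)
    (U : Ω → 𝓤) : Prop where
  measurable_init : ∀ k, Measurable (X₀ k)
  measurable_noise : ∀ k i, Measurable (W k i)
  measurable_seed : Measurable U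
  law_noise : ∀ k i, P.map (W k i) = gaussianReal 0 (s k)
  indep_noise : iIndepFun (fun (p : Fin 2 × ℕ) => W p.1 p.2) P
  indep_init : IndepFun (fun ω => (U ω, fun k => X₀ k ω))
    (fun ω => fun (p : Fin 2 × ℕ) => W p.1 p.2 ω) P

end Bandit

/-!
Gaussian KL-UCB is the classical UCB rule with bonus `√(2 v log t / plays)` (`gaussianIndex_eq`).
It underexplores when the optimal arm, arm `0`, has a bad start: if the first `m` rewards of
arm `0` have a mean so low that even with the bonus `√(2 v log (m + n) / m)` its index lies below
a lower bound of all sample means of arm `1`, then arm `0` is not played again until arm `1` has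
been played `n` times (`le_numPlays_or_numPlays_le`).

Take `n = ⌈x⌉` and `m = ⌈r² log x⌉` with a small constant `r`. The bonus of arm `0` is then about
`√(2 v) / r`, independently of `x`, so a constant mean of about `-√(2 v) / r` is low enough. As the
AR(1) recursion relaxes geometrically to its fixed point, this is achieved if each of the first
`m` noise terms of arm `0` is at most `-θ` with `θ ≈ (1 - β 0) √(2 v) / r`
(`ar1_mean_le_of_noise_le`). By the Gaussian tail this event has probability about
`exp (-m θ² / (2 s 0)) ≈ x ^ (-(v / s 0) (1 - β 0)²)`; the errors in the exponent vanish as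
`r → 0` (`exists_scale`). That the initial values are bounded and that the sample means of arm `1`
are bounded below has positive probability, independently of `x` and of the noise of arm `0`, by
the strong law of large numbers (`exists_bounds_pos`). The product of these probabilities is the
bound on the tail (`exists_forall_le_log_tail`); no change of measure is needed.

The growth of the expectation follows from Markov's inequality at `x = T / 2`.
-/

namespace Bandit

/-! ### Deterministic behaviour of Gaussian KL-UCB -/

lemma plays_snoc {K t : ℕ} (h : History K t) (k : Fin K) (r : ℝ) (j : Fin K) :
    plays (Fin.snoc (α := fun _ => Fin K × ℝ) h (k, r) : History K (t + 1)) j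
      = plays h j + if k = j then 1 else 0 := by
  simp only [plays, Finset.card_filter, Fin.sum_univ_castSucc, Fin.snoc_castSucc, Fin.snoc_last]

lemma plays_add_plays {t : ℕ} (h : History 2 t) : plays h 0 + plays h 1 = t := by
  have hc := Finset.card_filter_add_card_filter_not (s := (Finset.univ : Finset (Fin t)))
    (fun s => (h s).1 = 0)
  have h1 : (Finset.univ.filter fun s : Fin t => ¬ (h s).1 = 0)
      = Finset.univ.filter fun s : Fin t => (h s).1 = 1 := by
    refine Finset.filter_congr fun s _ => ?_
    generalize (h s).1 = a
    fin_cases a <;> simp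
  rw [h1] at hc
  simpa [plays] using hc

variable {𝓤 : Type*}

lemma numPlays_zero {K : ℕ} (π : Policy 𝓤 K) (u : 𝓤) (x : Fin K → ℕ → ℝ) (k : Fin K) :
    numPlays π u x k 0 = 0 := by
  simp [numPlays, plays]

lemma numPlays_succ {K : ℕ} (π : Policy 𝓤 K) (u : 𝓤) (x : Fin K → ℕ → ℝ) (k : Fin K) (T : ℕ) :
    numPlays π u x k (T + 1)
      = numPlays π u x k T + if π T u (history π u x T) = k then 1 else 0 :=
  plays_snoc _ _ _ _

lemma numPlays_add_numPlays (π : Policy 𝓤 2) (u : 𝓤) (x : Fin 2 → ℕ → ℝ) (T : ℕ) :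
    numPlays π u x 0 T + numPlays π u x 1 T = T :=
  plays_add_plays _

/-- The rewards of arm `k` in the history of a run are the first terms of its reward sequence. -/
lemma sum_history {K : ℕ} (π : Policy 𝓤 K) (u : 𝓤) (x : Fin K → ℕ → ℝ) (k : Fin K) (T : ℕ) :
    ∑ s ∈ Finset.univ.filter (fun s : Fin T => (history π u x T s).1 = k), (history π u x T s).2
      = ∑ i ∈ Finset.Icc 1 (numPlays π u x k T), x k i := by
  induction T with
  | zero => simp [numPlays_zero]
  | succ T ih =>
    rw [numPlays_succ]
    rw [Finset.sum_filter] at ih ⊢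
    rw [Fin.sum_univ_castSucc]
    simp only [history, Fin.snoc_castSucc, Fin.snoc_last]
    rw [ih]
    split_ifs with hk
    · rw [Finset.sum_Icc_succ_top (by omega), hk]
      rfl
    · simp

lemma sampleMean_history {K : ℕ} (π : Policy 𝓤 K) (u : 𝓤) (x : Fin K → ℕ → ℝ) (k : Fin K)
    (T : ℕ) :
    sampleMean (history π u x T) k
      = (∑ i ∈ Finset.Icc 1 (numPlays π u x k T), x k i) / numPlays π u x k T := by
  rw [sampleMean, sum_history]
  rfl

/-- The Gaussian KL-UCB index is the classical UCB index. -/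
lemma gaussianIndex_eq {v : ℝ≥0} (hv : 0 < v) {K t : ℕ} (h : History K t) (k : Fin K) :
    gaussianIndex v h k
      = sampleMean h k + √(2 * v * (Real.log t / plays h k)) := by
  have hv' : (0 : ℝ) < v := by exact_mod_cast hv
  set q : ℝ := Real.log t / plays h k with hq
  have hq0 : 0 ≤ q := div_nonneg (Real.log_natCast_nonneg t) (Nat.cast_nonneg _)
  have hset : {m : ℝ | InformationTheory.klDiv (gaussianReal (sampleMean h k) v)
      (gaussianReal m v) ≤ ENNReal.ofReal q}
      = Icc (sampleMean h k - √(2 * v * q)) (sampleMean h k + √(2 * v * q)) := by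
    ext m
    rw [mem_ofPred_eq, klDiv_gaussianReal_gaussianReal _ _ hv.ne', ENNReal.ofReal_le_ofReal_iff hq0,
      div_le_iff₀ (by positivity), mul_comm q, Real.sq_le (by positivity), mem_Icc]
    constructor <;> rintro ⟨h1, h2⟩ <;> constructor <;> linarith
  rw [gaussianIndex, ← hq, hset, csSup_Icc]
  linarith [Real.sqrt_nonneg (2 * v * q)]

/-- If the first `m` rewards of arm `0` are so low that its index stays below a lower bound `-K`
of all sample means of arm `1`, then arm `0` is not played again before arm `1` has been
played `n` times. -/
lemma le_numPlays_or_numPlays_le {v : ℝ≥0} (hv : 0 < v) {π : Policy 𝓤 2}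
    (hπ : IsGaussianKLUCB v π) (u : 𝓤) (x : Fin 2 → ℕ → ℝ) {m n : ℕ} (hm : 1 ≤ m) {K : ℝ}
    (h0 : (∑ i ∈ Finset.Icc 1 m, x 0 i) / m + √(2 * v * (Real.log (m + n) / m)) < -K)
    (h1 : ∀ j ≥ 1, -K ≤ (∑ i ∈ Finset.Icc 1 j, x 1 i) / j) (T : ℕ) :
    n ≤ numPlays π u x 1 T ∨ numPlays π u x 0 T ≤ m := by
  induction T with
  | zero => right; simp [numPlays_zero]
  | succ T ih =>
    rw [numPlays_succ, numPlays_succ]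
    rcases ih with ih | ih
    · left; omega
    by_cases hn : n ≤ numPlays π u x 1 T
    · left; omega
    right
    rcases ih.lt_or_eq with ih | ih
    · split_ifs <;> omega
    -- arm `0` has been played exactly `m` times: the next play is one of arm `1`
    suffices hne : π T u (history π u x T) ≠ 0 by rw [if_neg hne]; omega
    intro heq
    have hT := numPlays_add_numPlays π u x T
    by_cases hz : numPlays π u x 1 T = 0
    · have := hπ.explore T u (history π u x T) ⟨1, hz⟩
      rw [heq] at this
      change numPlays π u x 0 T = 0 at this
      omega
    have hall : ∀ k, plays (history π u x T) k ≠ 0 := by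
      intro k
      change numPlays π u x k T ≠ 0
      fin_cases k
      · change numPlays π u x 0 T ≠ 0
        omega
      · exact hz
    have hle := hπ.exploit T u (history π u x T) hall 1
    rw [heq, gaussianIndex_eq hv, gaussianIndex_eq hv, sampleMean_history,
      sampleMean_history] at hle
    change _ + _ ≤ _ + √(2 * v * (Real.log T / (numPlays π u x 0 T : ℕ))) at hle
    rw [ih] at hle
    have hj := h1 _ (Nat.one_le_iff_ne_zero.mpr hz)
    have hlog : √(2 * v * (Real.log T / m)) ≤ √(2 * v * (Real.log (m + n) / m)) := by
      have hT1 : 0 < (T : ℝ) := by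
        have : 0 < T := by omega
        exact_mod_cast this
      have hTle : (T : ℝ) ≤ m + n := by
        have : T ≤ m + n := by omega
        exact_mod_cast this
      gcongr
    have := Real.sqrt_nonneg (2 * v * (Real.log T / plays (history π u x T) 1))
    linarith

/-- The number of plays of an arm is a random variable. -/
lemma measurable_numPlays {Ω : Type*} [MeasurableSpace Ω] [MeasurableSpace 𝓤] {K : ℕ}
    {π : Policy 𝓤 K} (hπ : ∀ t, Measurable fun p : 𝓤 × History K t => π t p.1 p.2)
    {U : Ω → 𝓤} (hU : Measurable U) {X : Fin K → Ω → ℕ → ℝ}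
    (hX : ∀ k i, Measurable fun ω => X k ω i) (k : Fin K) (T : ℕ) :
    Measurable fun ω => numPlays π (U ω) (fun k => X k ω) k T := by
  have hplays : ∀ (T : ℕ) (k : Fin K), Measurable fun h : History K T => plays h k := by
    intro T k
    simp only [plays, Finset.card_filter]
    refine Finset.measurable_sum _ fun s _ => ?_
    have : Measurable fun h : History K T => (h s).1 := by fun_prop
    exact (Measurable.of_discrete (f := fun a : Fin K => if a = k then 1 else 0)).comp this
  have hhist : ∀ T, Measurable fun ω => history π (U ω) (fun k => X k ω) T := by
    intro T
    induction T with
    | zero =>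
      refine measurable_pi_iff.mpr fun s => s.elim0
    | succ T ih =>
      have hchoice : Measurable fun ω => π T (U ω) (history π (U ω) (fun k => X k ω) T) :=
        (hπ T).comp (hU.prodMk ih)
      refine measurable_pi_iff.mpr fun s => ?_
      induction s using Fin.lastCases with
      | cast s =>
        simp only [history, Fin.snoc_castSucc]
        exact (measurable_pi_apply s).comp ih
      | last =>
        simp only [history, Fin.snoc_last]
        refine hchoice.prodMk ?_
        -- the reward is read off at a random arm and a random index, both from countable types
        have hread : Measurable fun p : (Fin K × ℕ) × (Fin K → ℕ → ℝ) => p.2 p.1.1 p.1.2 :=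
          measurable_from_prod_countable_right fun q =>
            (measurable_pi_apply q.2).comp (measurable_pi_apply q.1)
        have hnum : Measurable fun ω => plays (history π (U ω) (fun k => X k ω) T)
            (π T (U ω) (history π (U ω) (fun k => X k ω) T)) + 1 := by
          have hsel : Measurable fun p : Fin K × History K T => plays p.2 p.1 :=
            measurable_from_prod_countable_right fun q => hplays T q
          exact (hsel.comp (hchoice.prodMk ih)).add_const 1
        have hXm : Measurable fun ω => fun k => X k ω :=
          measurable_pi_iff.mpr fun k => measurable_pi_iff.mpr fun i => hX k i
        exact hread.comp ((hchoice.prodMk hnum).prodMk hXm)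
  exact (hplays T k).comp (hhist T)

/-! ### The AR(1) recursion -/

lemma ar1_mono_init {α β : ℝ} (hβ : 0 ≤ β) {x y : ℝ} (hxy : x ≤ y) (w : ℕ → ℝ) (i : ℕ) :
    ar1 α β x w i ≤ ar1 α β y w i := by
  induction i with
  | zero => exact hxy
  | succ i ih =>
    simp only [ar1]
    gcongr

lemma measurable_ar1 (α β : ℝ) (i : ℕ) :
    Measurable fun p : ℝ × (ℕ → ℝ) => ar1 α β p.1 p.2 i := by
  induction i with
  | zero => exact measurable_fst
  | succ i ih =>
    simp only [ar1]
    exact ((ih.const_mul β).const_add α).add ((measurable_pi_apply i).comp measurable_snd)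

/-- If the noise stays below `-θ`, the AR(1) sequence relaxes geometrically to below the fixed
point `(α - θ) / (1 - β)` of the recursion with noise `-θ`. -/
lemma ar1_le_of_noise_le {α β θ x D : ℝ} (hβ : β ∈ Ioo (0 : ℝ) 1) {w : ℕ → ℝ} {m : ℕ}
    (hw : ∀ j < m, w j ≤ -θ) (hD : x - (α - θ) / (1 - β) ≤ D) {i : ℕ} (hi : i ≤ m) :
    ar1 α β x w i ≤ (α - θ) / (1 - β) + D * β ^ i := by
  induction i with
  | zero => simp only [ar1, pow_zero, mul_one]; linarith
  | succ i ih =>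
    have h1 := mul_le_mul_of_nonneg_left (ih (by omega)) hβ.1.le
    have h2 := hw i (by omega)
    have h3 : (1 - β) * ((α - θ) / (1 - β)) = α - θ :=
      mul_div_cancel₀ _ (by linarith [hβ.2])
    simp only [ar1, pow_succ]
    nlinarith

/-- If the noise stays below `-θ`, the sample mean of the AR(1) sequence is at most
`(α - θ) / (1 - β)`, up to the transient contribution of the initial value. -/
lemma ar1_mean_le_of_noise_le {α β θ x D : ℝ} (hβ : β ∈ Ioo (0 : ℝ) 1) {w : ℕ → ℝ} {m : ℕ}
    (hm : 1 ≤ m) (hw : ∀ j < m, w j ≤ -θ) (hD : x - (α - θ) / (1 - β) ≤ D) (hD0 : 0 ≤ D)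
    (hDm : D / (1 - β) ≤ m) :
    (∑ i ∈ Finset.Icc 1 m, ar1 α β x w i) / m ≤ (α - θ) / (1 - β) + 1 := by
  have hm0 : (0 : ℝ) < m := by exact_mod_cast hm
  have hβ1 : 0 < 1 - β := by linarith [hβ.2]
  have hgeom : ∑ i ∈ Finset.Icc 1 m, β ^ i ≤ (1 - β)⁻¹ := by
    rw [← tsum_geometric_of_lt_one hβ.1.le hβ.2]
    exact (summable_geometric_of_lt_one hβ.1.le hβ.2).sum_le_tsum _
      fun i _ => pow_nonneg hβ.1.le i
  rw [div_le_iff₀ hm0]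
  calc ∑ i ∈ Finset.Icc 1 m, ar1 α β x w i
      ≤ ∑ i ∈ Finset.Icc 1 m, ((α - θ) / (1 - β) + D * β ^ i) :=
        Finset.sum_le_sum fun i hi => ar1_le_of_noise_le hβ hw hD (Finset.mem_Icc.mp hi).2
    _ = m * ((α - θ) / (1 - β)) + D * ∑ i ∈ Finset.Icc 1 m, β ^ i := by
        rw [Finset.sum_add_distrib, ← Finset.mul_sum]; simp
    _ ≤ m * ((α - θ) / (1 - β)) + D * (1 - β)⁻¹ := by gcongr
    _ ≤ ((α - θ) / (1 - β) + 1) * m := by rw [← div_eq_mul_inv]; linarith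

/-- A stable linear recursion with vanishing input tends to `0`. -/
lemma tendsto_zero_of_le_mul_add {β : ℝ} (hβ : β ∈ Ioo (0 : ℝ) 1) {y e : ℕ → ℝ}
    (hy : ∀ n, 0 ≤ y n) (hrec : ∀ n, y (n + 1) ≤ β * y n + e n) (he : Tendsto e atTop (𝓝 0)) :
    Tendsto y atTop (𝓝 0) := by
  have hβ1 : 0 < 1 - β := by linarith [hβ.2]
  rw [Metric.tendsto_atTop]
  intro ε hε
  obtain ⟨n₀, hn₀⟩ := eventually_atTop.mp
    (he.eventually_le_const (show (0 : ℝ) < ε / 2 * (1 - β) by positivity))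
  have hdecay : ∀ k, y (n₀ + k) ≤ ε / 2 + β ^ k * y n₀ := by
    intro k
    induction k with
    | zero => simp; positivity
    | succ k ih =>
      have h1 := hrec (n₀ + k)
      have h2 := hn₀ (n₀ + k) (by omega)
      have h3 := mul_le_mul_of_nonneg_left ih hβ.1.le
      rw [pow_succ, ← add_assoc]
      nlinarith
  have hlim : Tendsto (fun k : ℕ => β ^ k * y n₀) atTop (𝓝 0) := by
    simpa using (tendsto_pow_atTop_nhds_zero_of_lt_one hβ.1.le hβ.2).mul_const (y n₀)
  obtain ⟨k₀, hk₀⟩ := eventually_atTop.mp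
    (hlim.eventually_lt_const (show (0 : ℝ) < ε / 2 by positivity))
  refine ⟨n₀ + k₀, fun n hn => ?_⟩
  obtain ⟨k, rfl⟩ := Nat.exists_eq_add_of_le (le_trans (Nat.le_add_right n₀ k₀) hn)
  rw [Real.dist_eq, sub_zero, abs_of_nonneg (hy _)]
  linarith [hdecay k, hk₀ k (by omega)]

/-- The noise averages determine the averages of the AR(1) sequence, whatever the initial value:
summing the recursion gives
`(1 - β) ∑ X i = n α + β (X 0 - X n) + ∑ w i`, and `X n / n → 0`. -/
lemma tendsto_ar1_mean {α β : ℝ} (hβ : β ∈ Ioo (0 : ℝ) 1) (x : ℝ) {w : ℕ → ℝ}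
    (hw : Tendsto (fun n : ℕ => (∑ i ∈ Finset.range n, w i) / n) atTop (𝓝 0)) :
    Tendsto (fun n : ℕ => (∑ i ∈ Finset.Icc 1 n, ar1 α β x w i) / n) atTop
      (𝓝 (α / (1 - β))) := by
  have hβ1 : 0 < 1 - β := by linarith [hβ.2]
  have hsum : ∀ n : ℕ, (1 - β) * ∑ i ∈ Finset.Icc 1 n, ar1 α β x w i
      = n * α + β * (x - ar1 α β x w n) + ∑ i ∈ Finset.range n, w i := by
    intro n
    induction n with
    | zero => simp [ar1]
    | succ n ih =>
      rw [Finset.sum_Icc_succ_top (by omega), mul_add, ih, Finset.sum_range_succ]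
      simp only [ar1]
      push_cast
      ring
  have hinv : Tendsto (fun n : ℕ => ((n : ℝ) + 1)⁻¹) atTop (𝓝 0) := by
    simpa using tendsto_one_div_add_atTop_nhds_zero_nat (𝕜 := ℝ)
  -- the single noise terms are `o(n)`, as differences of consecutive partial sums
  have hwn : Tendsto (fun n : ℕ => w n / ((n : ℝ) + 1)) atTop (𝓝 0) := by
    have h1 := hw.comp (tendsto_add_atTop_nat 1)
    have h2 : Tendsto (fun n : ℕ => (∑ i ∈ Finset.range n, w i) / n * (1 - ((n : ℝ) + 1)⁻¹))
        atTop (𝓝 0) := by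
      simpa using hw.mul (hinv.const_sub 1)
    have h3 := h1.sub h2
    rw [sub_zero] at h3
    refine h3.congr fun n => ?_
    simp only [Function.comp_apply, Finset.sum_range_succ]
    rcases Nat.eq_zero_or_pos n with rfl | hn
    · simp
    · have : (n : ℝ) ≠ 0 := by positivity
      have : (n : ℝ) + 1 ≠ 0 := by positivity
      push_cast
      field_simp
      ring
  have hXn : Tendsto (fun n : ℕ => ar1 α β x w n / n) atTop (𝓝 0) := by
    rw [tendsto_zero_iff_abs_tendsto_zero]
    refine tendsto_zero_of_le_mul_add hβ
      (e := fun n : ℕ => β * (if n = 0 then |x| else 0) + (|α| * ((n : ℝ) + 1)⁻¹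
        + |w n / ((n : ℝ) + 1)|)) (fun n => abs_nonneg _) (fun n => ?_) ?_
    · have hn1 : (0 : ℝ) < n + 1 := by positivity
      have hstep : |ar1 α β x w n| / ((n : ℝ) + 1)
          ≤ |ar1 α β x w n / n| + if n = 0 then |x| else 0 := by
        rcases Nat.eq_zero_or_pos n with rfl | hn
        · simp [ar1]
        · have hn0 : (0 : ℝ) < n := by exact_mod_cast hn
          rw [if_neg hn.ne', add_zero, abs_div, Nat.abs_cast]
          gcongr
          linarith
      have habs : |ar1 α β x w (n + 1)| ≤ |α| + β * |ar1 α β x w n| + |w n| := by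
        simp only [ar1]
        refine (abs_add_le _ _).trans ?_
        gcongr
        refine (abs_add_le _ _).trans ?_
        rw [abs_mul, abs_of_pos hβ.1]
      have hdiv := div_le_div_of_nonneg_right habs hn1.le
      have h4 := mul_le_mul_of_nonneg_left hstep hβ.1.le
      simp only [Function.comp_apply, abs_div, Nat.abs_cast, abs_of_pos hn1] at h4 ⊢
      push_cast
      rw [add_div, add_div, mul_div_assoc, div_eq_mul_inv |α|] at hdiv
      linarith
    · have h0 : Tendsto (fun n : ℕ => if n = 0 then |x| else 0) atTop (𝓝 0) := by
        refine tendsto_const_nhds.congr' ?_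
        filter_upwards [eventually_ne_atTop 0] with n hn
        rw [if_neg hn]
      simpa using (h0.const_mul β).add ((hinv.const_mul |α|).add hwn.abs)
  have hxn : Tendsto (fun n : ℕ => x / n) atTop (𝓝 0) :=
    tendsto_const_nhds.div_atTop tendsto_natCast_atTop_atTop
  have hlim : Tendsto (fun n : ℕ => (α + β * (x / n - ar1 α β x w n / n)
      + (∑ i ∈ Finset.range n, w i) / n) / (1 - β)) atTop (𝓝 (α / (1 - β))) := by
    simpa using ((((hxn.sub hXn).const_mul β).const_add α).add hw).div_const (1 - β)
  refine hlim.congr' ?_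
  filter_upwards [eventually_ne_atTop 0] with n hn
  have hn0 : (n : ℝ) ≠ 0 := by exact_mod_cast hn
  have hS : ∑ i ∈ Finset.Icc 1 n, ar1 α β x w i
      = (n * α + β * (x - ar1 α β x w n) + ∑ i ∈ Finset.range n, w i) / (1 - β) := by
    rw [← hsum, mul_div_cancel_left₀ _ hβ1.ne']
  rw [hS]
  field_simp

/-! ### The noise -/

/-- Lower bound for a Gaussian tail: on `[-(θ + 1), -θ]`, of length `1`, the density is at least
its value at `-(θ + 1)`. -/
lemma le_gaussianReal_Iic_neg {s : ℝ≥0} (hs : 0 < s) {θ : ℝ} (hθ : 0 ≤ θ) :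
    (√(2 * Real.pi * s))⁻¹ * Real.exp (-(θ + 1) ^ 2 / (2 * s))
      ≤ (gaussianReal 0 s).real (Iic (-θ)) := by
  rw [Measure.real, gaussianReal_apply_eq_integral _ hs.ne',
    ENNReal.toReal_ofReal (setIntegral_nonneg measurableSet_Iic
      fun x _ => gaussianPDFReal_nonneg _ _ _)]
  have hint : IntegrableOn (gaussianPDFReal 0 s) (Iic (-θ)) :=
    (integrable_gaussianPDFReal 0 s).integrableOn
  calc (√(2 * Real.pi * s))⁻¹ * Real.exp (-(θ + 1) ^ 2 / (2 * s))
      = ∫ _ in Icc (-(θ + 1)) (-θ),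
          (√(2 * Real.pi * s))⁻¹ * Real.exp (-(θ + 1) ^ 2 / (2 * s)) := by
        rw [setIntegral_const, Real.volume_real_Icc_of_le (by linarith)]
        simp
    _ ≤ ∫ x in Icc (-(θ + 1)) (-θ), gaussianPDFReal 0 s x := by
        refine setIntegral_mono_on (integrableOn_const (by simp))
          (integrable_gaussianPDFReal 0 s).integrableOn measurableSet_Icc fun x hx => ?_
        have hx2 : x ^ 2 ≤ (θ + 1) ^ 2 := sq_le_sq' hx.1 (by linarith [hx.2])
        rw [gaussianPDFReal, sub_zero]
        gcongr
    _ ≤ ∫ x in Iic (-θ), gaussianPDFReal 0 s x :=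
        setIntegral_mono_set hint (ae_of_all _ fun x => gaussianPDFReal_nonneg _ _ _)
          (Icc_subset_Iic_self).eventuallyLE

variable {Ω 𝓤 : Type*} [MeasurableSpace Ω] [MeasurableSpace 𝓤] {P : Measure Ω}
  {s : Fin 2 → ℝ≥0} {X₀ : Fin 2 → Ω → ℝ} {W : Fin 2 → ℕ → Ω → ℝ} {U : Ω → 𝓤}

namespace IsGaussianAR1Env

/-- The strong law of large numbers for the noise. -/
lemma ae_tendsto_noise_mean (henv : IsGaussianAR1Env P s X₀ W U) (k : Fin 2) :
    ∀ᵐ ω ∂P, Tendsto (fun n : ℕ => (∑ i ∈ Finset.range n, W k i ω) / n) atTop (𝓝 0) := by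
  have hid : ∀ i, IdentDistrib (W k i) (W k 0) P P := fun i =>
    ⟨(henv.measurable_noise k i).aemeasurable, (henv.measurable_noise k 0).aemeasurable, by
      rw [henv.law_noise, henv.law_noise]⟩
  have hlaw : IdentDistrib (W k 0) id P (gaussianReal 0 (s k)) :=
    ⟨(henv.measurable_noise k 0).aemeasurable, aemeasurable_id, by
      rw [henv.law_noise, Measure.map_id]⟩
  have hint : Integrable (W k 0) P :=
    hlaw.integrable_iff.mpr ((memLp_id_gaussianReal 1).integrable le_rfl)
  have hmean : ∫ ω, W k 0 ω ∂P = 0 := by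
    rw [hlaw.integral_eq]
    exact integral_id_gaussianReal
  have h := strong_law_ae_real (W k) hint (fun i j hij => henv.indep_noise.indepFun
    (i := (k, i)) (j := (k, j)) (by simpa using hij)) hid
  rwa [hmean] at h

/-- The noise of the two arms is independent, as processes. -/
lemma indepFun_noise (henv : IsGaussianAR1Env P s X₀ W U) :
    IndepFun (fun ω i => W 1 i ω) (fun ω i => W 0 i ω) P := by
  have h := indep_iSup_of_disjoint (fun p : Fin 2 × ℕ => (henv.measurable_noise p.1 p.2).comap_le)
    henv.indep_noise.iIndep (S := {p | p.1 = 1}) (T := {p | p.1 = 0})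
    (by rw [Set.disjoint_left]; rintro ⟨a, b⟩ h1 h2; simp_all)
  rw [IndepFun_iff_Indep]
  refine indep_of_indep_of_le_left (indep_of_indep_of_le_right h ?_) ?_
  all_goals
    rw [MeasurableSpace.pi, MeasurableSpace.comap_iSup]
    refine iSup_le fun i => ?_
    rw [MeasurableSpace.comap_comp]
  · exact le_iSup₂_of_le (f := fun (p : Fin 2 × ℕ) (_ : p ∈ {p : Fin 2 × ℕ | p.1 = 0}) =>
      MeasurableSpace.comap (W p.1 p.2) inferInstance) (0, i) rfl le_rfl
  · exact le_iSup₂_of_le (f := fun (p : Fin 2 × ℕ) (_ : p ∈ {p : Fin 2 × ℕ | p.1 = 1}) =>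
      MeasurableSpace.comap (W p.1 p.2) inferInstance) (1, i) rfl le_rfl

/-- Events on the initial values, on the noise of arm `1`, and the event that the first `m` noise
terms of arm `0` are below a level, are independent. -/
lemma real_inter_eq (henv : IsGaussianAR1Env P s X₀ W U) {E : Set (Fin 2 → ℝ)}
    (hE : MeasurableSet E) {G : Set (ℕ → ℝ)} (hG : MeasurableSet G) (b : ℝ) (m : ℕ) :
    P.real {ω | (fun k => X₀ k ω) ∈ E ∧ (fun i => W 1 i ω) ∈ G ∧ ∀ j < m, W 0 j ω ≤ b}
      = P.real {ω | (fun k => X₀ k ω) ∈ E} * P.real {ω | (fun i => W 1 i ω) ∈ G}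
        * (gaussianReal 0 (s 0)).real (Iic b) ^ m := by
  have hL : MeasurableSet {w : ℕ → ℝ | ∀ j < m, w j ≤ b} := by measurability
  have hE' : MeasurableSet {p : 𝓤 × (Fin 2 → ℝ) | p.2 ∈ E} := measurable_snd hE
  have hG' : MeasurableSet {w : Fin 2 × ℕ → ℝ | (fun i => w (1, i)) ∈ G
      ∧ (fun i => w (0, i)) ∈ {w : ℕ → ℝ | ∀ j < m, w j ≤ b}} := by
    have h (k : Fin 2) : Measurable fun (w : Fin 2 × ℕ → ℝ) (i : ℕ) => w (k, i) := by fun_prop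
    exact (h 1 hG).inter (h 0 hL)
  have h1 := henv.indep_init.measure_inter_preimage_eq_mul _ _ hE' hG'
  have h2 := henv.indepFun_noise.measure_inter_preimage_eq_mul _ _ hG hL
  have h3 := (henv.indep_noise.precomp (g := fun j : ℕ => ((0 : Fin 2), j))
    (fun i j h => by simpa using h)).measure_inter_preimage_eq_mul (Finset.range m)
    (sets := fun _ => Iic b) (fun _ _ => measurableSet_Iic)
  have h4 : ∀ j, P (W 0 j ⁻¹' Iic b) = gaussianReal 0 (s 0) (Iic b) := fun j => by
    rw [← henv.law_noise 0 j, Measure.map_apply (henv.measurable_noise 0 j) measurableSet_Iic]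
  simp only [h4, Finset.prod_const, Finset.card_range] at h3
  have h5 : ⋂ i ∈ Finset.range m, W 0 i ⁻¹' Iic b
      = (fun ω i => W 0 i ω) ⁻¹' {w : ℕ → ℝ | ∀ j < m, w j ≤ b} := by
    ext ω; simp
  rw [h5] at h3
  rw [h3] at h2
  have h6 := h1.trans (congrArg _ h2)
  simp only [Measure.real, ← ENNReal.toReal_pow, ← ENNReal.toReal_mul]
  rw [mul_assoc]
  exact congrArg ENNReal.toReal h6

end IsGaussianAR1Env

/-- A property that holds almost surely for some `K : ℕ` has positive probability for some `K`. -/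
lemma exists_real_pos_of_ae [IsProbabilityMeasure P] {q : ℕ → Ω → Prop}
    (h : ∀ᵐ ω ∂P, ∃ K, q K ω) : ∃ K, 0 < P.real {ω | q K ω} := by
  obtain ⟨K, hK⟩ := exists_measure_pos_of_not_measure_iUnion_null (μ := P)
    (s := fun K => {ω | q K ω}) (by
      have hU : ∀ᵐ ω ∂P, ω ∈ ⋃ K, {ω | q K ω} := by simpa using h
      exact fun h0 => one_ne_zero <|
        measure_univ.symm.trans ((measure_congr (eventuallyEq_univ.mpr hU)).symm.trans h0))
  exact ⟨K, ENNReal.toReal_pos hK.ne' (measure_ne_top _ _)⟩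

/-! ### The tail of the number of plays of the sub-optimal arm -/

section Tail

lemma measurableSet_le_ar1_mean (α β x b : ℝ) :
    MeasurableSet {w : ℕ → ℝ | ∀ j : ℕ, 1 ≤ j →
      b ≤ (∑ i ∈ Finset.Icc 1 j, ar1 α β x w i) / j} := by
  simp only [ofPred_forall]
  refine .iInter fun j => .iInter fun _ => measurableSet_le measurable_const ?_
  exact (Finset.measurable_sum _ fun i _ =>
    (measurable_ar1 α β i).comp measurable_prodMk_left).div_const _

variable {Ω 𝓤 : Type*} [MeasurableSpace Ω] [MeasurableSpace 𝓤] {P : Measure Ω}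
  {s : Fin 2 → ℝ≥0} {X₀ : Fin 2 → Ω → ℝ} {W : Fin 2 → ℕ → Ω → ℝ} {U : Ω → 𝓤}

/-- With positive probability the initial values are bounded, and all sample means of arm `1` are
bounded below even if its initial value is replaced by the lower bound `-K`. -/
lemma exists_bounds_pos [IsProbabilityMeasure P] (henv : IsGaussianAR1Env P s X₀ W U) {α β : ℝ}
    (hβ : β ∈ Ioo (0 : ℝ) 1) :
    ∃ K K' : ℕ, 0 < P.real {ω | |X₀ 0 ω| ≤ K ∧ -(K : ℝ) ≤ X₀ 1 ω} ∧
      0 < P.real {ω | ∀ j : ℕ, 1 ≤ j →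
        -(K' : ℝ) ≤ (∑ i ∈ Finset.Icc 1 j, ar1 α β (-K) (fun i => W 1 i ω) i) / j} := by
  obtain ⟨K, hK⟩ := exists_real_pos_of_ae (P := P)
    (q := fun K ω => |X₀ 0 ω| ≤ (K : ℕ) ∧ -(K : ℝ) ≤ X₀ 1 ω) (ae_of_all _ fun ω => by
      obtain ⟨K, hK⟩ := exists_nat_ge (max |X₀ 0 ω| (-X₀ 1 ω))
      exact ⟨K, (le_max_left _ _).trans hK, by linarith [(le_max_right _ _).trans hK]⟩)
  obtain ⟨K', hK'⟩ := exists_real_pos_of_ae (P := P)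
    (q := fun K' ω => ∀ j : ℕ, 1 ≤ j →
        -((K' : ℕ) : ℝ) ≤ (∑ i ∈ Finset.Icc 1 j, ar1 α β (-K) (fun i => W 1 i ω) i) / j) (by
      filter_upwards [henv.ae_tendsto_noise_mean 1] with ω hω
      obtain ⟨b, hb⟩ := (tendsto_ar1_mean (α := α) hβ (-K) hω).bddBelow_range
      obtain ⟨K', hK'⟩ := exists_nat_ge (-b)
      exact ⟨K', fun j _ => by linarith [hb (mem_range_self j)]⟩)
  exact ⟨K, K', hK, hK'⟩

/-- The choice of the constants. Up to lower order terms, `θ = A / r` is the level below which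
the noise of arm `0` has to stay during its first `r ^ 2 * log x` plays, and each such play
costs a factor `exp (-θ ^ 2 / (2 * s))`; the total exponent of `x` tends to
`A ^ 2 / (2 * s)` as `r → 0`. -/
lemma exists_scale {s : ℝ≥0} (hs : 0 < s) {A B c : ℝ} (hA : 0 < A) (hc : A ^ 2 / (2 * s) < c) :
    ∃ r > 0, 0 < (gaussianReal 0 s).real (Iic (-(A / r + B))) ∧
      r ^ 2 * -Real.log ((gaussianReal 0 s).real (Iic (-(A / r + B)))) < c := by
  have hs' : (0 : ℝ) < s := by exact_mod_cast hs
  set C : ℝ := (√(2 * Real.pi * s))⁻¹ with hC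
  have hC0 : 0 < C := by positivity
  have h1 : Tendsto (fun r : ℝ => (A + (B + 1) * r) ^ 2 / (2 * s) - r ^ 2 * Real.log C) (𝓝[>] 0)
      (𝓝 (A ^ 2 / (2 * s))) := by
    have : Continuous fun r : ℝ => (A + (B + 1) * r) ^ 2 / (2 * s) - r ^ 2 * Real.log C := by
      fun_prop
    simpa using (this.tendsto 0).mono_left nhdsWithin_le_nhds
  have h2 : Tendsto (fun r : ℝ => A + B * r) (𝓝[>] 0) (𝓝 A) := by
    have : Continuous fun r : ℝ => A + B * r := by fun_prop
    simpa using (this.tendsto 0).mono_left nhdsWithin_le_nhds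
  obtain ⟨r, hr1, hr2, hr⟩ := ((h1.eventually_lt_const hc).and
    ((h2.eventually_const_lt hA).and self_mem_nhdsWithin)).exists
  have hr : 0 < r := hr
  have hθ : 0 ≤ A / r + B := by
    have : A / r + B = (A + B * r) / r := by field_simp
    rw [this]
    positivity
  have hle := le_gaussianReal_Iic_neg hs hθ
  rw [← hC] at hle
  have hpos := lt_of_lt_of_le (by positivity) hle
  refine ⟨r, hr, hpos, lt_of_le_of_lt ?_ hr1⟩
  have hlog := Real.log_le_log (by positivity) hle
  rw [Real.log_mul hC0.ne' (Real.exp_ne_zero _), Real.log_exp] at hlog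
  have hr2 := mul_le_mul_of_nonneg_left hlog (sq_nonneg r)
  have : r ^ 2 * (Real.log C + -(A / r + B + 1) ^ 2 / (2 * s))
      = -((A + (B + 1) * r) ^ 2 / (2 * s) - r ^ 2 * Real.log C) := by
    field_simp
    ring
  rw [this] at hr2
  linarith

/-- The regret tail, in the range of all large `x` that leave time for the `a * log x` plays of
the optimal arm. -/
lemma exists_forall_le_log_tail [IsProbabilityMeasure P] {v : ℝ≥0} (hv : 0 < v) {π : Policy 𝓤 2}
    (hπ : IsGaussianKLUCB v π) {α β : Fin 2 → ℝ} (hβ : ∀ k, β k ∈ Ioo (0 : ℝ) 1)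
    (hs : ∀ k, 0 < s k) (henv : IsGaussianAR1Env P s X₀ W U) {ε : ℝ} (hε : 0 < ε) :
    ∃ a > 0, ∀ᶠ x : ℝ in atTop, ∀ T : ℕ, x + a * Real.log x + 2 ≤ T →
      0 < P.real {ω | x ≤ numPlays π (U ω)
        (fun k => ar1 (α k) (β k) (X₀ k ω) (fun i => W k i ω)) 1 T} ∧
      -(v / s 0 * (1 - β 0) ^ 2) - ε
        ≤ Real.log (P.real {ω | x ≤ numPlays π (U ω)
          (fun k => ar1 (α k) (β k) (X₀ k ω) (fun i => W k i ω)) 1 T}) / Real.log x := by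
  have hv' : (0 : ℝ) < v := by exact_mod_cast hv
  have hs' : (0 : ℝ) < s 0 := by exact_mod_cast hs 0
  have hβ1 : 0 < 1 - β 0 := by linarith [(hβ 0).2]
  set c : ℝ := v / s 0 * (1 - β 0) ^ 2 with hc
  have hc0 : 0 < c := by positivity
  obtain ⟨K, K', hK, hK'⟩ := exists_bounds_pos henv (α := α 1) (hβ 1)
  set p₁ := P.real {ω | |X₀ 0 ω| ≤ K ∧ -(K : ℝ) ≤ X₀ 1 ω} with hp₁
  set p₂ := P.real {ω | ∀ j : ℕ, 1 ≤ j →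
    -(K' : ℝ) ≤ (∑ i ∈ Finset.Icc 1 j, ar1 (α 1) (β 1) (-K) (fun i => W 1 i ω) i) / j} with hp₂
  -- `η` absorbs the difference between `log x` and the logarithm of the time horizon
  set η : ℝ := ε / (2 * c) with hη
  have hη0 : 0 < η := by positivity
  set R : ℝ := √(2 * v * (1 + η)) with hR
  have hR0 : 0 < R := Real.sqrt_pos.mpr (by positivity)
  have hR2 : R ^ 2 = 2 * v * (1 + η) := Real.sq_sqrt (by positivity)
  have hcost : ((1 - β 0) * R) ^ 2 / (2 * s 0) < c + 3 / 4 * ε := by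
    have h1 : ((1 - β 0) * R) ^ 2 / (2 * s 0) = c * (1 + η) := by
      rw [mul_pow, hR2, hc]
      field_simp
    have h2 : c * η = ε / 2 := by rw [hη]; field_simp
    rw [h1, mul_add, h2]
    linarith
  -- `B` is such that the level `θ` gives arm `0` the mean `-R / r - K' - 2`
  set B : ℝ := α 0 + (1 - β 0) * (K' + 2) with hB
  obtain ⟨r, hr, hQ, hrQ⟩ := exists_scale (hs 0) (A := (1 - β 0) * R) (B := B)
    (by positivity) hcost
  set θ : ℝ := (1 - β 0) * R / r + B with hθ
  set Q := (gaussianReal 0 (s 0)).real (Iic (-θ)) with hQdef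
  have hQ1 : Real.log Q ≤ 0 := Real.log_nonpos hQ.le measureReal_le_one
  set y : ℝ := (α 0 - θ) / (1 - β 0) with hy
  have hyval : y = -(R / r) - K' - 2 := by
    rw [hy, hθ, hB]
    field_simp
    ring
  set D : ℝ := K + |y| with hD
  have hD0 : 0 ≤ D := by positivity
  refine ⟨r ^ 2, by positivity, ?_⟩
  have hlogT := Real.tendsto_log_atTop
  have hlin : ∀ᶠ x : ℝ in atTop, r ^ 2 * Real.log x ≤ x := by
    have := (Real.isLittleO_log_id_atTop.bound (inv_pos.mpr (show 0 < r ^ 2 by positivity)))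
    filter_upwards [this, eventually_ge_atTop 1] with x hx hx1
    rw [Real.norm_of_nonneg (Real.log_nonneg hx1), id, Real.norm_of_nonneg (by linarith)] at hx
    rwa [← div_eq_inv_mul, le_div_iff₀' (by positivity)] at hx
  filter_upwards [eventually_ge_atTop 2, hlin, hlogT.eventually_ge_atTop 1,
    hlogT.eventually_ge_atTop (Real.log 3 / η),
    hlogT.eventually_ge_atTop (D / (1 - β 0) / r ^ 2),
    hlogT.eventually_ge_atTop ((-Real.log Q - Real.log (p₁ * p₂)) / (ε / 4))]
    with x hx2 hxlin hx1 hxη hxD hxε T hT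
  have hlx : 0 < Real.log x := by linarith
  set m := ⌈r ^ 2 * Real.log x⌉₊ with hm
  set n := ⌈x⌉₊ with hn
  have hm_ge : r ^ 2 * Real.log x ≤ m := Nat.le_ceil _
  have hm_lt : (m : ℝ) < r ^ 2 * Real.log x + 1 := Nat.ceil_lt_add_one (by positivity)
  have hn_ge : x ≤ n := Nat.le_ceil _
  have hn_lt : (n : ℝ) < x + 1 := Nat.ceil_lt_add_one (by linarith)
  have hm1 : 1 ≤ m := Nat.ceil_pos.mpr (by positivity)
  have hm0 : (0 : ℝ) < m := by exact_mod_cast hm1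
  have hDm : D / (1 - β 0) ≤ m := by
    rw [div_le_iff₀' (by positivity)] at hxD
    linarith
  have hbonus : √(2 * v * (Real.log (m + n) / m)) ≤ R / r := by
    have h1 : Real.log (m + n) ≤ (1 + η) * Real.log x := by
      rw [div_le_iff₀' hη0] at hxη
      calc Real.log (m + n) ≤ Real.log (3 * x) :=
            Real.log_le_log (by positivity) (by linarith)
        _ = Real.log 3 + Real.log x := Real.log_mul (by norm_num) (by linarith)
        _ ≤ _ := by linarith
    have h2 : Real.log (m + n) / m ≤ (1 + η) / r ^ 2 := by
      rw [div_le_div_iff₀ hm0 (by positivity)]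
      have h3 := mul_le_mul_of_nonneg_left hm_ge (show 0 ≤ 1 + η by positivity)
      have h4 := mul_le_mul_of_nonneg_right h1 (sq_nonneg r)
      linarith
    rw [Real.sqrt_le_left (by positivity), div_pow, hR2, mul_div_assoc]
    gcongr
  -- on the product event, the second arm is played at least `x` times
  have hsub : {ω | (fun k => X₀ k ω) ∈ {z : Fin 2 → ℝ | |z 0| ≤ K ∧ -(K : ℝ) ≤ z 1} ∧
      (fun i => W 1 i ω) ∈ {w : ℕ → ℝ | ∀ j : ℕ, 1 ≤ j →
        -(K' : ℝ) ≤ (∑ i ∈ Finset.Icc 1 j, ar1 (α 1) (β 1) (-K) w i) / j} ∧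
      ∀ j < m, W 0 j ω ≤ -θ} ⊆ {ω | x ≤ numPlays π (U ω)
        (fun k => ar1 (α k) (β k) (X₀ k ω) (fun i => W k i ω)) 1 T} := by
    rintro ω ⟨⟨hz0, hz1⟩, hG, hW⟩
    have hlow := ar1_mean_le_of_noise_le (α := α 0) (x := X₀ 0 ω) (w := fun i => W 0 i ω) (hβ 0)
      hm1 hW (D := D) (by linarith [neg_abs_le y, le_abs_self (X₀ 0 ω)]) hD0 hDm
    have hpl := le_numPlays_or_numPlays_le hv hπ (U ω)
      (fun k => ar1 (α k) (β k) (X₀ k ω) (fun i => W k i ω)) (n := n) hm1 (K := K')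
      (by linarith) (fun j hj => (hG j hj).trans (by
        gcongr with i _
        exact ar1_mono_init (hβ 1).1.le hz1 _ _)) T
    have hadd := numPlays_add_numPlays π (U ω)
      (fun k => ar1 (α k) (β k) (X₀ k ω) (fun i => W k i ω)) T
    have hmn : m + n ≤ T := by
      have : (m + n : ℝ) ≤ T := by linarith
      exact_mod_cast this
    have hle : n ≤ numPlays π (U ω)
        (fun k => ar1 (α k) (β k) (X₀ k ω) (fun i => W k i ω)) 1 T := by omega
    exact hn_ge.trans (by exact_mod_cast hle)
  have hprob := henv.real_inter_eq (E := {z : Fin 2 → ℝ | |z 0| ≤ K ∧ -(K : ℝ) ≤ z 1})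
    (by measurability)
    (G := {w : ℕ → ℝ | ∀ j : ℕ, 1 ≤ j →
        -(K' : ℝ) ≤ (∑ i ∈ Finset.Icc 1 j, ar1 (α 1) (β 1) (-K) w i) / j})
    (measurableSet_le_ar1_mean _ _ _ _) (-θ) m
  have hle : p₁ * p₂ * Q ^ m ≤ P.real {ω | x ≤ numPlays π (U ω)
      (fun k => ar1 (α k) (β k) (X₀ k ω) (fun i => W k i ω)) 1 T} :=
    hprob.symm.trans_le (measureReal_mono hsub)
  have hpos : 0 < p₁ * p₂ * Q ^ m := by positivity
  refine ⟨hpos.trans_le hle, ?_⟩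
  rw [le_div_iff₀ hlx]
  refine le_trans ?_ (Real.log_le_log hpos hle)
  rw [Real.log_mul (by positivity) (by positivity), Real.log_pow]
  rw [div_le_iff₀' (by positivity)] at hxε
  have h1 := mul_le_mul_of_nonneg_right hm_lt.le (neg_nonneg.mpr hQ1)
  have h2 := mul_le_mul_of_nonneg_right hrQ.le hlx.le
  linarith

end Tail

end Bandit

/-! ### The regret tail and the expected regret -/

lemma eventually_mul_log_add_two_le (a : ℝ) {κ : ℝ} (hκ : 0 < κ) :
    ∀ᶠ t : ℝ in atTop, a * Real.log t + 2 ≤ κ * t := by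
  have h : (fun t : ℝ => a * Real.log t + 2) =o[atTop] (id : ℝ → ℝ) :=
    (Real.isLittleO_log_id_atTop.const_mul_left a).add
      (Asymptotics.isLittleO_const_id_atTop 2)
  filter_upwards [h.bound hκ, eventually_ge_atTop 0] with t ht ht0
  rw [id, Real.norm_of_nonneg ht0] at ht
  exact (le_abs_self _).trans ht

theorem corollary2 {Ω 𝓤 : Type*} [MeasurableSpace Ω] [MeasurableSpace 𝓤]
    (P : Measure Ω) [IsProbabilityMeasure P]
    -- the algorithm: Gaussian KL-UCB with assumed variance `v`
    (v : ℝ≥0) (hv : 0 < v)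
    (π : Bandit.Policy 𝓤 2) (hπ : Bandit.IsGaussianKLUCB v π)
    (hπ_meas : ∀ t, Measurable fun p : 𝓤 × Bandit.History 2 t => π t p.1 p.2)
    -- the environment: arm `k` has coefficients `α k`, `β k` and noise variance `s k`
    (α β : Fin 2 → ℝ) (s : Fin 2 → ℝ≥0)
    (hβ : ∀ k, β k ∈ Ioo (0 : ℝ) 1) (hs : ∀ k, 0 < s k)
    (X₀ : Fin 2 → Ω → ℝ) (W : Fin 2 → ℕ → Ω → ℝ) (U : Ω → 𝓤)
    (henv : Bandit.IsGaussianAR1Env P s X₀ W U)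
    (X : Fin 2 → Ω → ℕ → ℝ)
    (hX : ∀ k ω, X k ω = Bandit.ar1 (α k) (β k) (X₀ k ω) (fun i => W k i ω))
    -- the second arm has the smaller long-run mean
    (hsub : α 1 / (1 - β 1) < α 0 / (1 - β 0))
    -- `N T ω` is the number of plays of the second arm up to time `T`
    (N : ℕ → Ω → ℕ)
    (hN : ∀ T ω, N T ω = Bandit.numPlays π (U ω) (fun k => X k ω) 1 T) :
    -- the long-run means
    (∀ k, ∀ᵐ ω ∂P, Tendsto (fun n : ℕ => (∑ i ∈ Finset.Icc 1 n, X k ω i) / n) atTop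
      (𝓝 (α k / (1 - β k)))) ∧
    -- the regret tail, uniformly in `x`
    (∀ γ ∈ Ioo (0 : ℝ) 1, ∀ ε > (0 : ℝ), ∀ᶠ T : ℕ in atTop,
      ∀ x ∈ Icc (Real.log T ^ (1 + γ)) ((1 - γ) * T),
        0 < P.real {ω | x ≤ N T ω} ∧
        -(v / s 0 * (1 - β 0) ^ 2) - ε ≤ Real.log (P.real {ω | x ≤ N T ω}) / Real.log x) ∧
    -- correctly specified marginals: polynomial growth of the expected regret
    ((∀ k, (v : ℝ) = s k / (1 - β k ^ 2)) →
      v / s 0 * (1 - β 0) ^ 2 = (1 - β 0) / (1 + β 0) ∧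
      ∀ δ ∈ Ioo (0 : ℝ) ((1 + β 0) / (1 - β 0) - 1),
        1 ≤ liminf (fun T : ℕ =>
          (((∫ ω, (N T ω : ℝ) ∂P) / (T : ℝ) ^ (1 - (1 + δ) * ((1 - β 0) / (1 + β 0))) : ℝ) :
            EReal)) atTop) := by
  obtain rfl : X = fun k ω => Bandit.ar1 (α k) (β k) (X₀ k ω) (fun i => W k i ω) :=
    funext fun k => funext fun ω => hX k ω
  obtain rfl : N = fun T ω => Bandit.numPlays π (U ω)
      (fun k => Bandit.ar1 (α k) (β k) (X₀ k ω) (fun i => W k i ω)) 1 T :=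
    funext fun T => funext fun ω => hN T ω
  refine ⟨fun k => ?_, fun γ hγ ε hε => ?_, fun hmarg => ?_⟩
  · filter_upwards [henv.ae_tendsto_noise_mean k] with ω hω
    exact Bandit.tendsto_ar1_mean (hβ k) _ hω
  · obtain ⟨a, ha, htail⟩ := Bandit.exists_forall_le_log_tail hv hπ (α := α) hβ hs henv hε
    obtain ⟨x₀, hx₀⟩ := eventually_atTop.mp htail
    have hlow : Tendsto (fun T : ℕ => Real.log T ^ (1 + γ)) atTop atTop :=
      (tendsto_rpow_atTop (by linarith [hγ.1])).comp
        (Real.tendsto_log_atTop.comp tendsto_natCast_atTop_atTop)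
    filter_upwards [hlow.eventually_ge_atTop (max x₀ 1),
      tendsto_natCast_atTop_atTop.eventually (eventually_mul_log_add_two_le a hγ.1)]
      with T hT1 hT2 x hx
    have hx1 : max x₀ 1 ≤ x := hT1.trans hx.1
    have hxpos : 0 < x := lt_of_lt_of_le one_pos ((le_max_right _ _).trans hx1)
    refine hx₀ x ((le_max_left _ _).trans hx1) T ?_
    have hxT : x ≤ T := hx.2.trans
      (mul_le_of_le_one_left (Nat.cast_nonneg T) (by linarith [hγ.1]))
    have := mul_le_mul_of_nonneg_left (Real.log_le_log hxpos hxT) ha.le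
    linarith [hx.2]
  have hs0 : (0 : ℝ) < s 0 := by exact_mod_cast hs 0
  have hβ0 := (hβ 0).1
  have hβ1 : 0 < 1 - β 0 := by linarith [(hβ 0).2]
  have hρ : (v : ℝ) / s 0 * (1 - β 0) ^ 2 = (1 - β 0) / (1 + β 0) := by
    have : 1 - β 0 ^ 2 = (1 - β 0) * (1 + β 0) := by ring
    rw [hmarg 0, this]
    field_simp
  refine ⟨hρ, fun δ hδ => ?_⟩
  set ρ : ℝ := (1 - β 0) / (1 + β 0) with hρdef
  have hρ0 : 0 < ρ := by positivity
  set ε : ℝ := δ * ρ / 2 with hε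
  have hε0 : 0 < ε := by have := hδ.1; positivity
  set p : ℝ := 1 - (1 + δ) * ρ with hp
  obtain ⟨a, ha, htail⟩ := Bandit.exists_forall_le_log_tail hv hπ (α := α) hβ hs henv hε0
  rw [hρ] at htail
  have hhalf : Tendsto (fun T : ℕ => (T : ℝ) / 2) atTop atTop :=
    tendsto_natCast_atTop_atTop.atTop_div_const two_pos
  refine le_liminf_of_le (by isBoundedDefault) ?_
  filter_upwards [hhalf.eventually htail,
    hhalf.eventually (eventually_mul_log_add_two_le a one_pos),
    hhalf.eventually ((tendsto_rpow_atTop hε0).eventually_ge_atTop ((2 : ℝ) ^ p)),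
    hhalf.eventually_gt_atTop 1] with T hT htime hpow hT1
  obtain ⟨hpos, hlog⟩ := hT T (by linarith)
  set x : ℝ := (T : ℝ) / 2 with hx
  have hx0 : 0 < x := by linarith
  have hTx : (T : ℝ) = 2 * x := by rw [hx]; ring
  have hmeas : Measurable fun ω => Bandit.numPlays π (U ω)
      (fun k => Bandit.ar1 (α k) (β k) (X₀ k ω) (fun i => W k i ω)) 1 T :=
    Bandit.measurable_numPlays hπ_meas henv.measurable_seed
      (X := fun k ω => Bandit.ar1 (α k) (β k) (X₀ k ω) (fun i => W k i ω))
      (fun k i => (Bandit.measurable_ar1 (α k) (β k) i).comp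
        ((henv.measurable_init k).prodMk
          (measurable_pi_iff.mpr fun j => henv.measurable_noise k j))) 1 T
  have hint : Integrable (fun ω => ((Bandit.numPlays π (U ω)
      (fun k => Bandit.ar1 (α k) (β k) (X₀ k ω) (fun i => W k i ω)) 1 T : ℕ) : ℝ)) P := by
    refine Integrable.of_bound (measurable_from_nat.comp hmeas).aestronglyMeasurable T
      (ae_of_all _ fun ω => ?_)
    rw [Real.norm_natCast]
    exact_mod_cast (Nat.le_add_left _ _).trans_eq (Bandit.numPlays_add_numPlays π (U ω) _ T)
  have hmarkov := mul_meas_ge_le_integral_of_nonneg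
    (ae_of_all _ fun ω => Nat.cast_nonneg _) hint x
  -- the power `x ^ (δ * ρ / 2)` gained over the claimed rate beats the factor `2 ^ p` that is lost
  -- by taking `x = T / 2`
  have hprob : x ^ (-ρ - ε) ≤ P.real {ω | x ≤ Bandit.numPlays π (U ω)
      (fun k => Bandit.ar1 (α k) (β k) (X₀ k ω) (fun i => W k i ω)) 1 T} := by
    rw [le_div_iff₀ (Real.log_pos hT1)] at hlog
    rw [Real.rpow_def_of_pos hx0, ← Real.le_log_iff_exp_le hpos, mul_comm]
    exact hlog
  have hTpow : (0 : ℝ) < (T : ℝ) ^ p := Real.rpow_pos_of_pos (by linarith) _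
  have hmain : (T : ℝ) ^ p ≤ ∫ ω, ((Bandit.numPlays π (U ω)
      (fun k => Bandit.ar1 (α k) (β k) (X₀ k ω) (fun i => W k i ω)) 1 T : ℕ) : ℝ) ∂P := by
    calc (T : ℝ) ^ p = 2 ^ p * x ^ p := by rw [hTx, Real.mul_rpow two_pos.le hx0.le]
      _ ≤ x ^ ε * x ^ p := by gcongr
      _ = x * x ^ (-ρ - ε) := by
        have : x * x ^ (-ρ - ε) = x ^ (1 + (-ρ - ε)) := by
          rw [Real.rpow_add hx0, Real.rpow_one]
        rw [this, ← Real.rpow_add hx0]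
        congr 1
        rw [hp, hε]
        ring
      _ ≤ _ := (mul_le_mul_of_nonneg_left hprob hx0.le).trans hmarkov
  exact_mod_cast (one_le_div hTpow).mpr hmain
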